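/- Let $R$ be a commutative Noetherian ring, $M$ a finitely generated $R$-module and $N$ a submodule of $M$ with $\mathrm{Ass}_R(M/N)=\{\mathfrak p_1,\dots,\mathfrak p_n\}$ ($\mathfrak p_i$ pairwise distinct). Let $N=Q_1\cap\cdots\cap Q_n$ be an irredundant primary decomposition of $N$, where $Q_i$ is $\mathfrak p_i$-primary for all $i$; here "irredundant" means that the primes of the components are pairwise distinct and that no component contains the intersection of the others. For a submodule $L$ of $M$, let $\mathrm{ir}_M(L)$ be the index of reducibility of $L$, that is, the number of components of an irredundant decomposition of $L$ as a finite intersection of irreducible submodules of $M$ (this number does not depend on the decomposition; a proper submodule is irreducible if it is not the intersection of two strictly larger submodules, and $\mathrm{ir}_M(M)=0$). A prime $\mathfrak p\in\mathrm{Ass}_R(M/N)$ is embedded if it is not minimal in $\mathrm{Ass}_R(M/N)$. For $\mathfrak p\in\mathrm{Ass}_R(M/N)$ let $\bigwedge_{\mathfrak p}(N)$ be the set of all $\mathfrak p$-primary submodules of $M$ that appear in some irredundant primary decomposition of $N$; for an embedded prime $\mathfrak p$, a $\mathfrak p$-maximal embedded component of $N$ is an element of $\bigwedge_{\mathfrak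 p}(N)$ that is maximal with respect to inclusion. Then $$\mathrm{ir}_M(N)=\mathrm{ir}_M(Q_1)+\cdots+\mathrm{ir}_M(Q_n)$$ if and only if $Q_i$ is a $\mathfrak p_i$-maximal embedded component of $N$ for every $i$ such that $\mathfrak p_i$ is an embedded associated prime of $N$. -/

import Mathlib

namespace Submodule

variable {R M : Type*} [CommRing R] [AddCommGroup M] [Module R M]

/-- A finite set `s` of submodules is an irredundant irreducible decomposition of `N`: the members
intersect to `N`, each is irreducible, and none contains the intersection of the others. -/
structure IsIrredundantIrreducibleDecomposition (N : Submodule R M)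
    (s : Finset (Submodule R M)) : Prop where
  inf_eq : s.inf id = N
  irreducible : ∀ ⦃J⦄, J ∈ s → InfIrred J
  irredundant : ∀ ⦃J⦄, J ∈ s → ¬ sInf ((s : Set (Submodule R M)) \ {J}) ≤ J

/-- The index of reducibility of `N` in `M`: the number of components of an irredundant irreducible
decomposition of `N`. In a Noetherian module such decompositions exist
(`exists_irredundantIrreducibleDecomposition`) and all have this number of components
(`IsIrredundantIrreducibleDecomposition.card_eq`), so the infimum is over a singleton. -/
noncomputable def indexOfReducibility (N : Submodule R M) : ℕ :=
  sInf {k | ∃ s : Finset (Submodule R M),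
    N.IsIrredundantIrreducibleDecomposition s ∧ s.card = k}

/-- The set of `p`-primary submodules of `M` that appear in an irredundant primary decomposition
of `N`. -/
def primaryComponents (N : Submodule R M) (p : Ideal R) : Set (Submodule R M) :=
  {Q | Q.IsPrimary ∧ (Q.colon Set.univ).radical = p ∧
    ∃ t : Finset (Submodule R M), N.IsMinimalPrimaryDecomposition t ∧ Q ∈ t}

/-- `p` is an embedded associated prime of `N`: an associated prime of `M ⧸ N` that is not minimal
among the associated primes of `M ⧸ N`. -/
def IsEmbeddedPrime (N : Submodule R M) (p : Ideal R) : Prop :=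
  p ∈ associatedPrimes R (M ⧸ N) ∧ ¬ Minimal (· ∈ associatedPrimes R (M ⧸ N)) p

/-- `Q` is a `p`-maximal embedded component of `N`: a maximal element, with respect to inclusion,
of the set of `p`-primary components of `N`. -/
def IsMaximalEmbeddedComponent (N : Submodule R M) (p : Ideal R) (Q : Submodule R M) : Prop :=
  Maximal (· ∈ N.primaryComponents p) Q

section WellDefined

theorem exists_irredundantIrreducibleDecomposition [IsNoetherian R M] (N : Submodule R M) :
    ∃ s : Finset (Submodule R M), N.IsIrredundantIrreducibleDecomposition s := by
  classical
  obtain ⟨s, hs, hirr⟩ := exists_infIrred_decomposition N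
  obtain ⟨t, hts, ht, h⟩ := decomposition_erase_inf hs
  refine ⟨t, ht, fun J hJ ↦ hirr (hts hJ), fun J hJ hle ↦ h hJ ?_⟩
  rwa [Finset.inf_id_eq_sInf, Finset.coe_erase]

theorem exists_replace {N x c : Submodule R M} (hx : InfIrred x) (hxc : x ⊓ c = N)
    {t : Finset (Submodule R M)} (ht : t.inf id = N) : ∃ y ∈ t, c ⊓ y = N := by
  classical
  have key : ∀ u v : Submodule R M, N ≤ u → u ≤ c → N ≤ v → v ≤ c → u ⊓ v = N →
      u = N ∨ v = N := by
    intro u v hu huc hv hvc huv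
    have aux : ∀ z : Submodule R M, N ≤ z → z ≤ c → (x ⊔ z) ⊓ c = z := by
      intro z hz hzc
      rw [sup_comm, sup_inf_assoc_of_le x hzc, hxc, sup_eq_left.mpr hz]
    have hw : (x ⊔ u) ⊓ (x ⊔ v) = x := by
      have h1 : ((x ⊔ u) ⊓ (x ⊔ v)) ⊓ c = N := by
        rw [inf_inf_distrib_right, aux u hu huc, aux v hv hvc, huv]
      have h2 : (x ⊔ u) ⊓ (x ⊔ v) ≤ x ⊔ c := inf_le_left.trans (sup_le_sup_left huc x)
      have h3 : x ≤ (x ⊔ u) ⊓ (x ⊔ v) := le_inf le_sup_left le_sup_left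
      calc (x ⊔ u) ⊓ (x ⊔ v) = (x ⊔ c) ⊓ ((x ⊔ u) ⊓ (x ⊔ v)) := (inf_eq_right.mpr h2).symm
        _ = x ⊔ c ⊓ ((x ⊔ u) ⊓ (x ⊔ v)) := sup_inf_assoc_of_le c h3
        _ = x := by rw [inf_comm c, h1, sup_eq_left, ← hxc]; exact inf_le_left
    refine (hx.2 hw).imp (fun h ↦ ?_) (fun h ↦ ?_)
    · exact le_antisymm (hxc ▸ le_inf (sup_eq_left.mp h) huc) hu
    · exact le_antisymm (hxc ▸ le_inf (sup_eq_left.mp h) hvc) hv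
  have hNc : N ≤ c := hxc ▸ inf_le_right
  have main : ∀ s ⊆ t, c ⊓ s.inf id = N → c = N ∨ ∃ y ∈ s, c ⊓ y = N := by
    intro s
    induction s using Finset.induction_on with
    | empty => intro _ h; left; simpa using h
    | insert y s _ ih =>
      intro hst h
      have hyN : N ≤ y := ht ▸ Finset.inf_le (hst (Finset.mem_insert_self y s))
      have hsN : N ≤ s.inf id :=
        ht ▸ Finset.inf_mono ((Finset.subset_insert y s).trans hst)
      rw [Finset.inf_insert, id, inf_inf_distrib_left] at h
      rcases key _ _ (le_inf hNc hyN) inf_le_left (le_inf hNc hsN) inf_le_left h with h | h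
      · exact Or.inr ⟨y, Finset.mem_insert_self y s, h⟩
      · exact (ih ((Finset.subset_insert y s).trans hst) h).imp id
          fun ⟨z, hz, h⟩ ↦ ⟨z, Finset.mem_insert_of_mem hz, h⟩
  rcases main t subset_rfl (by rw [ht, inf_eq_right.mpr hNc]) with h | h
  · rcases t.eq_empty_or_nonempty with rfl | ⟨y, hy⟩
    · refine absurd ?_ hx.ne_top
      rw [← top_le_iff, ← Finset.inf_empty (f := id), ht, ← hxc]
      exact inf_le_left
    · refine ⟨y, hy, ?_⟩
      rw [h, inf_eq_left, ← ht]
      exact Finset.inf_le hy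
  · exact h

namespace IsIrredundantIrreducibleDecomposition

theorem card_le {N : Submodule R M} {s t : Finset (Submodule R M)}
    (hs : N.IsIrredundantIrreducibleDecomposition s)
    (ht : N.IsIrredundantIrreducibleDecomposition t) : t.card ≤ s.card := by
  classical
  have main : ∀ s : Finset (Submodule R M), (∀ J ∈ s, InfIrred J) → ∀ c : Submodule R M,
      s.inf id ⊓ c = N → ∃ v ⊆ t, v.card ≤ s.card ∧ v.inf id ⊓ c = N := by
    intro s
    induction s using Finset.induction_on with
    | empty => intro _ c h; exact ⟨∅, by simp, by simp, h⟩
    | insert x s hxs ih =>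
      intro hirr c h
      rw [Finset.inf_insert, id, inf_assoc] at h
      obtain ⟨y, hy, hyN⟩ := exists_replace (hirr x (Finset.mem_insert_self x s)) h ht.inf_eq
      obtain ⟨v, hvt, hcard, hv⟩ := ih (fun J hJ ↦ hirr J (Finset.mem_insert_of_mem hJ)) (c ⊓ y)
        (by rw [← inf_assoc, hyN])
      refine ⟨insert y v, Finset.insert_subset hy hvt, ?_, ?_⟩
      · rw [Finset.card_insert_of_notMem hxs]
        exact (Finset.card_insert_le y v).trans (by omega)
      · rw [Finset.inf_insert, id, ← hv, inf_comm c, inf_left_comm, inf_assoc]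
  obtain ⟨v, hvt, hcard, hv⟩ := main s (fun J hJ ↦ hs.irreducible hJ) ⊤ (by simp [hs.inf_eq])
  suffices v = t by rwa [← this]
  refine hvt.antisymm fun J hJ ↦ ?_
  by_contra hJv
  refine ht.irredundant hJ ?_
  calc sInf ((t : Set (Submodule R M)) \ {J}) ≤ sInf (v : Set (Submodule R M)) :=
        sInf_le_sInf fun K hK ↦ ⟨hvt hK, fun h ↦ hJv (h ▸ hK)⟩
    _ = N := by rw [← Finset.inf_id_eq_sInf, ← hv, inf_top_eq]
    _ ≤ J := ht.inf_eq ▸ Finset.inf_le hJ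

/-- Noether: all irredundant irreducible decompositions of `N` have the same number of components,
the index of reducibility. -/
theorem card_eq {N : Submodule R M} {s : Finset (Submodule R M)}
    (hs : N.IsIrredundantIrreducibleDecomposition s) : s.card = N.indexOfReducibility := by
  obtain ⟨t, ht, h⟩ := Nat.sInf_mem (s := {k | ∃ s : Finset (Submodule R M),
    N.IsIrredundantIrreducibleDecomposition s ∧ s.card = k}) ⟨_, s, hs, rfl⟩
  rw [indexOfReducibility, ← h]
  exact le_antisymm (ht.card_le hs) (hs.card_le ht)

end IsIrredundantIrreducibleDecomposition

end WellDefined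

end Submodule

/-! For each `i` let `c` be the intersection of the components other than `Q i`, and call `Q i`
maximal against `c` if no strictly larger `Q'` satisfies `Q' ⊓ c ≤ Q i`. Additivity of the index
turns out to be a lattice matter: `indexOfReducibility_eq_sum_iff` shows, for arbitrary submodules,
that it holds exactly when every `Q i` is maximal against its `c`. The modular law enters through
`indexOfReducibility_inf_lt`.

Primary decomposition is needed only to interpret this condition. By `maximal_primaryComponents_iff`
it says that `Q i` is maximal among the primary components of `N` at its prime: a violating `Q'`
saturates to a primary one, and components at the same prime are interchangeable. By `eq_of_minimal`
it is automatic at minimal primes, so only embedded ones impose a condition. -/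

namespace Submodule

/-! ### Additivity of the index of reducibility, in the submodule lattice -/

section IndexOfReducibility

variable {R M : Type*} [CommRing R] [AddCommGroup M] [Module R M]

theorem exists_subset_irredundantIrreducibleDecomposition {N : Submodule R M}
    {s : Finset (Submodule R M)} (hs : s.inf id = N) (hirr : ∀ J ∈ s, InfIrred J) :
    ∃ t ⊆ s, N.IsIrredundantIrreducibleDecomposition t := by
  classical
  obtain ⟨t, hts, ht, h⟩ := decomposition_erase_inf hs
  refine ⟨t, hts, ht, fun J hJ ↦ hirr J (hts hJ), fun J hJ hle ↦ h hJ ?_⟩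
  rwa [Finset.inf_id_eq_sInf, Finset.coe_erase]

theorem indexOfReducibility_le_card {N : Submodule R M} {s : Finset (Submodule R M)}
    (hs : s.inf id = N) (hirr : ∀ J ∈ s, InfIrred J) : N.indexOfReducibility ≤ s.card := by
  obtain ⟨t, hts, ht⟩ := exists_subset_irredundantIrreducibleDecomposition hs hirr
  exact ht.card_eq ▸ Finset.card_le_card hts

variable [IsNoetherian R M]

theorem indexOfReducibility_inf_le (A B : Submodule R M) :
    (A ⊓ B).indexOfReducibility ≤ A.indexOfReducibility + B.indexOfReducibility := by
  classical
  obtain ⟨s, hs⟩ := exists_irredundantIrreducibleDecomposition A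
  obtain ⟨t, ht⟩ := exists_irredundantIrreducibleDecomposition B
  rw [← hs.card_eq, ← ht.card_eq]
  refine (indexOfReducibility_le_card (s := s ∪ t) ?_ fun J hJ ↦ ?_).trans
    (Finset.card_union_le s t)
  · rw [Finset.inf_union, hs.inf_eq, ht.inf_eq]
  · exact (Finset.mem_union.mp hJ).elim (fun h ↦ hs.irreducible h) fun h ↦ ht.irreducible h

theorem indexOfReducibility_finsetInf_le {ι : Type*} (s : Finset ι) (Q : ι → Submodule R M) :
    (s.inf Q).indexOfReducibility ≤ ∑ i ∈ s, (Q i).indexOfReducibility := by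
  classical
  induction s using Finset.induction_on with
  | empty => exact indexOfReducibility_le_card (s := ∅) (by simp) (by simp)
  | insert i s hi ih =>
    rw [Finset.inf_insert, Finset.sum_insert hi]
    exact (indexOfReducibility_inf_le _ _).trans (by gcongr)

/-- If `Q' > Q` meets `c` inside `Q`, then some irreducible component of `Q` is redundant in the
presence of `c`. -/
theorem indexOfReducibility_inf_lt {c Q Q' : Submodule R M} (hQ : Q < Q') (hc : Q' ⊓ c ≤ Q) :
    (Q ⊓ c).indexOfReducibility < Q.indexOfReducibility + c.indexOfReducibility := by
  classical
  obtain ⟨u, hu⟩ := exists_irredundantIrreducibleDecomposition Q'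
  -- By modularity `Q' ⊓ (c ⊔ Q) = (Q' ⊓ c) ⊔ Q = Q`, so components of `Q'` and `c ⊔ Q` together
  -- decompose `Q`.
  obtain ⟨v, hv⟩ := exists_irredundantIrreducibleDecomposition (c ⊔ Q)
  have huv : (u ∪ v).inf id = Q := by
    rw [Finset.inf_union, hu.inf_eq, hv.inf_eq, sup_comm, inf_comm, sup_inf_assoc_of_le c hQ.le,
      sup_eq_left, inf_comm]
    exact hc
  obtain ⟨t, htuv, ht⟩ := exists_subset_irredundantIrreducibleDecomposition huv fun J hJ ↦
    (Finset.mem_union.mp hJ).elim (fun h ↦ hu.irreducible h) fun h ↦ hv.irreducible h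
  -- Components of `Q'` alone cannot cut down to `Q < Q'`. The extra one comes from `c ⊔ Q`, hence
  -- contains `c` and can be dropped when intersecting with `c`.
  obtain ⟨y, hyt, hyu⟩ : ∃ y ∈ t, y ∉ u := by
    by_contra! h
    exact hQ.not_ge (hu.inf_eq ▸ ht.inf_eq ▸ Finset.inf_mono h)
  have hcy : c ≤ y := by
    have hy : v.inf id ≤ y := Finset.inf_le ((Finset.mem_union.mp (htuv hyt)).resolve_left hyu)
    exact le_sup_left.trans (hv.inf_eq ▸ hy)
  have hinf : (t.erase y).inf id ⊓ c = Q ⊓ c := by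
    rw [← ht.inf_eq, ← Finset.insert_erase hyt, Finset.inf_insert, Finset.erase_insert_eq_erase,
      Finset.erase_idem, id, inf_comm y, inf_assoc, inf_eq_right.mpr hcy]
  have hle := indexOfReducibility_le_card (s := t.erase y) rfl
    fun J hJ ↦ ht.irreducible (Finset.mem_of_mem_erase hJ)
  have hlt := Finset.card_erase_lt_of_mem hyt
  have := indexOfReducibility_inf_le ((t.erase y).inf id) c
  rw [hinf] at this
  rw [← ht.card_eq]
  omega

/-- A strict enlargement of some `Q i` makes one irreducible component superfluous, so the sum is
too big. Without such enlargements, the union of irredundant decompositions of the `Q i` is disjoint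
and irredundant, and counting its members gives the sum. -/
theorem indexOfReducibility_eq_sum_iff {ι : Type*} [Fintype ι] [DecidableEq ι]
    (Q : ι → Submodule R M) :
    (Finset.univ.inf Q).indexOfReducibility = ∑ i, (Q i).indexOfReducibility ↔
      ∀ i, ∀ Q', Q i ≤ Q' → Q' ⊓ (Finset.univ.erase i).inf Q ≤ Q i → Q' = Q i := by
  constructor
  · intro h i Q' hle hinf
    by_contra hne
    have hlt := indexOfReducibility_inf_lt (lt_of_le_of_ne' hle hne) hinf
    rw [← Finset.inf_insert, Finset.insert_erase (Finset.mem_univ i), h,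
      ← Finset.add_sum_erase _ _ (Finset.mem_univ i)] at hlt
    have := indexOfReducibility_finsetInf_le (Finset.univ.erase i) Q
    omega
  · intro h
    classical
    choose t ht using fun i ↦ exists_irredundantIrreducibleDecomposition (Q i)
    have hQle {i j : ι} {J : Submodule R M} (hJ : J ∈ t j) (hij : j ≠ i) :
        (Finset.univ.erase i).inf Q ≤ J :=
      (Finset.inf_le (Finset.mem_erase.mpr ⟨hij, Finset.mem_univ j⟩)).trans
        ((ht j).inf_eq ▸ Finset.inf_le (f := id) hJ)
    -- If `J` were redundant, the intersection of the other members of `t i` would be an admissible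
    -- enlargement of `Q i`, hence equal to it, making `J` redundant already in `t i`.
    have key {i : ι} {J : Submodule R M} (hJ : J ∈ t i) :
        ¬ sInf ((t i : Set (Submodule R M)) \ {J}) ⊓ (Finset.univ.erase i).inf Q ≤ J := by
      intro hle
      have hQi : sInf ((t i : Set (Submodule R M)) \ {J}) ⊓ J = Q i := by
        rw [← (ht i).inf_eq, ← Finset.coe_erase, ← Finset.inf_id_eq_sInf, inf_comm]
        conv_rhs => rw [← Finset.insert_erase hJ, Finset.inf_insert, id]
      refine (ht i).irredundant hJ ?_
      have heq : sInf ((t i : Set (Submodule R M)) \ {J}) = Q i :=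
        h i _ (hQi ▸ inf_le_left) ((le_inf inf_le_left hle).trans_eq hQi)
      rw [heq, ← hQi]
      exact inf_le_right
    have hdisj : Set.PairwiseDisjoint (↑(Finset.univ : Finset ι)) t := by
      intro i _ j _ hij
      refine Finset.disjoint_left.mpr fun J hi hj ↦ key hi ?_
      exact inf_le_right.trans (hQle hj hij.symm)
    have hdec : (Finset.univ.inf Q).IsIrredundantIrreducibleDecomposition
        (Finset.univ.biUnion t) := by
      refine ⟨?_, fun J hJ ↦ ?_, fun J hJ hle ↦ ?_⟩
      · rw [Finset.inf_biUnion]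
        exact Finset.inf_congr rfl fun i _ ↦ (ht i).inf_eq
      · obtain ⟨i, -, hi⟩ := Finset.mem_biUnion.mp hJ
        exact (ht i).irreducible hi
      · obtain ⟨i, -, hi⟩ := Finset.mem_biUnion.mp hJ
        refine key hi (le_trans (le_sInf ?_) hle)
        rintro K ⟨hK, hKJ⟩
        obtain ⟨j, -, hj⟩ := Finset.mem_biUnion.mp hK
        rcases eq_or_ne j i with rfl | hji
        · exact inf_le_left.trans (sInf_le ⟨hj, hKJ⟩)
        · exact inf_le_right.trans (hQle hj hji)
    rw [← hdec.card_eq, Finset.card_biUnion hdisj]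
    exact Finset.sum_congr rfl fun i _ ↦ (ht i).card_eq

end IndexOfReducibility

/-! ### Primary components and their maximality -/

section PrimaryComponents

variable {R M : Type*} [CommRing R] [AddCommGroup M] [Module R M]

theorem associatedPrimes_quotient_eq (N : Submodule R M) :
    _root_.associatedPrimes R (M ⧸ N) = N.associatedPrimes := by
  have h (x : M) : (⊥ : Submodule R (M ⧸ N)).colon {N.mkQ x} = N.colon {x} := by
    ext r
    rw [mem_colon_singleton, mem_colon_singleton, ← map_smul, mem_bot, mkQ_apply,
      Quotient.mk_eq_zero]
  ext I
  rw [AssociatedPrimes.mem_iff, IsAssociatedPrime, Submodule.isAssociatedPrime_def,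
    AssociatePrimes.mem_iff, Submodule.isAssociatedPrime_def, N.mkQ_surjective.exists]
  simp_rw [h]

theorem IsPrimary.mem_of_smul_mem {Q : Submodule R M} (hQ : Q.IsPrimary) {s : R} {x : M}
    (hs : s ∉ (Q.colon Set.univ).radical) (h : s • x ∈ Q) : x ∈ Q :=
  (hQ.mem_or_mem h).resolve_right hs

/-- The saturation of `Q` with respect to the multiplicative set `S`. -/
def saturation (S : Submonoid R) (Q : Submodule R M) : Submodule R M where
  carrier := {x | ∃ s ∈ S, s • x ∈ Q}
  zero_mem' := ⟨1, S.one_mem, by simp⟩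
  add_mem' := by
    rintro x y ⟨s, hs, hx⟩ ⟨r, hr, hy⟩
    refine ⟨s * r, S.mul_mem hs hr, ?_⟩
    rw [smul_add]
    refine Q.add_mem ?_ ?_
    · rw [mul_comm, mul_smul]
      exact Q.smul_mem r hx
    · rw [mul_smul]
      exact Q.smul_mem s hy
  smul_mem' := by
    rintro r x ⟨s, hs, hx⟩
    exact ⟨s, hs, smul_comm r s x ▸ Q.smul_mem r hx⟩

theorem le_saturation (S : Submonoid R) (Q : Submodule R M) : Q ≤ Q.saturation S :=
  fun x hx ↦ ⟨1, S.one_mem, by simpa using hx⟩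

/-- Modulo the saturation, elements outside `p` act injectively, while those of `p` act nilpotently
because they already do so modulo `Q`. -/
theorem isPrimary_saturation_primeCompl {Q : Submodule R M} {p : Ideal R} [p.IsPrime]
    (hp : p ≤ (Q.colon Set.univ).radical) (htop : Q.saturation p.primeCompl ≠ ⊤) :
    (Q.saturation p.primeCompl).IsPrimary ∧
      ((Q.saturation p.primeCompl).colon Set.univ).radical = p := by
  have hle : p ≤ ((Q.saturation p.primeCompl).colon Set.univ).radical :=
    hp.trans (Ideal.radical_mono (colon_mono (le_saturation _ Q) subset_rfl))
  have hmem {r : R} {x : M} (hr : r ∉ p) (h : r • x ∈ Q.saturation p.primeCompl) :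
      x ∈ Q.saturation p.primeCompl := by
    obtain ⟨s, hs, h⟩ := h
    exact ⟨s * r, p.primeCompl.mul_mem hs hr, by rwa [mul_smul]⟩
  refine ⟨⟨htop, fun {r x} h ↦ ?_⟩, le_antisymm (fun r hr ↦ ?_) hle⟩
  · by_cases hr : r ∈ p
    · right
      obtain ⟨k, hk⟩ := hle hr
      exact ⟨k, mem_colon_iff_le.mp hk⟩
    · exact Or.inl (hmem hr h)
  · by_contra hrp
    obtain ⟨k, hk⟩ := hr
    refine htop (eq_top_iff.mpr fun x _ ↦ ?_)
    exact hmem (fun h ↦ hrp (Ideal.IsPrime.mem_of_pow_mem ‹_› k h))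
      (mem_colon.mp hk x (Set.mem_univ x))

/-- Finitely many primary submodules with distinct primes, these being the associated primes of
their intersection, form a minimal primary decomposition. -/
theorem isMinimalPrimaryDecomposition_of_image_subset {N : Submodule R M}
    {t : Finset (Submodule R M)} (hinf : t.inf id = N) (hprim : ∀ J ∈ t, J.IsPrimary)
    (hinj : Set.InjOn (fun J : Submodule R M ↦ (J.colon Set.univ).radical) t)
    (himage : (fun J : Submodule R M ↦ (J.colon Set.univ).radical) '' t ⊆ N.associatedPrimes) :
    N.IsMinimalPrimaryDecomposition t := by
  -- The primes of an irredundant subfamily `u` already exhaust the associated primes, so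
  -- distinctness forces `u = t`.
  obtain ⟨u, hut, hu, hmin⟩ := decomposition_erase_inf hinf
  have hdec : N.IsMinimalPrimaryDecomposition u :=
    ⟨hu, fun J hJ ↦ hprim J (hut hJ), Set.injOn_iff_pairwise_ne.mp (hinj.mono hut), hmin⟩
  suffices t ⊆ u by rwa [this.antisymm hut]
  intro J hJ
  obtain ⟨K, hK, hKJ⟩ := hdec.image_radical_eq_associated_primes ▸ himage ⟨J, hJ, rfl⟩
  exact hinj (hut hK) hJ hKJ ▸ hK

namespace IsMinimalPrimaryDecomposition

variable {N : Submodule R M} {t : Finset (Submodule R M)}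

theorem inf_inf_erase (ht : N.IsMinimalPrimaryDecomposition t)
    {q : Submodule R M} (hq : q ∈ t) : q ⊓ (t.erase q).inf id = N := by
  rw [← ht.inf_eq]
  conv_rhs => rw [← Finset.insert_erase hq, Finset.inf_insert, id]

/-- Primary components belonging to the same prime can be exchanged between minimal primary
decompositions. -/
theorem inf_inf_erase_le_of_radical_eq
    {t' : Finset (Submodule R M)}
    (ht : N.IsMinimalPrimaryDecomposition t) (ht' : N.IsMinimalPrimaryDecomposition t')
    {q q' : Submodule R M} (hq : q ∈ t) (hq' : q' ∈ t')
    (h : (q'.colon Set.univ).radical = (q.colon Set.univ).radical) :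
    q' ⊓ (t.erase q).inf id ≤ N := by
  classical
  rintro x ⟨hxq', hxc⟩
  by_contra hxN
  have hxq : x ∉ q := fun hxq ↦ hxN (ht.inf_inf_erase hq ▸ ⟨hxq, hxc⟩)
  -- The radical of `N.colon {x}` is computed twice: through `t` it is the prime of `q`; through
  -- `t'` it is an intersection of primes of components other than `q'`. A prime equal to a finite
  -- intersection is one of its terms, against distinctness in `t'`.
  have h₁ : (N.colon {x}).radical = (q.colon Set.univ).radical := by
    rw [← (ht.primary hq).radical_colon_singleton_of_notMem hxq]
    congr 1
    ext r
    rw [mem_colon_singleton, mem_colon_singleton, ← ht.inf_inf_erase hq, mem_inf]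
    exact and_iff_left (smul_mem _ r hxc)
  have h₂ : (N.colon {x}).radical =
      ((t'.erase q').filter (x ∉ ·)).inf fun J ↦ (J.colon Set.univ).radical := by
    have h₃ : N.colon {x} = ((t'.erase q').inf id).colon {x} := by
      ext r
      rw [mem_colon_singleton, mem_colon_singleton, ← ht'.inf_inf_erase hq', mem_inf]
      exact and_iff_right (smul_mem _ r hxq')
    simp_rw [h₃, colon_finsetInf, ← Ideal.radicalInfTopHom_apply, map_finset_inf,
      Function.comp_def, Ideal.radicalInfTopHom_apply, id_eq]
    rw [Finset.inf_congr rfl fun J hJ ↦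
      (ht'.primary (Finset.mem_of_mem_erase hJ)).radical_colon_singleton_eq_ite x,
      Finset.inf_ite, Finset.inf_top, top_inf_eq]
  have hprime := (ht.primary hq).isPrime_radical_colon
  rw [← h₁, h₂] at hprime
  obtain ⟨J, hJ, hJeq⟩ := Ideal.eq_inf_of_isPrime_inf hprime
  rw [← h₂, h₁, ← h] at hJeq
  have hJ' := Finset.mem_erase.mp (Finset.mem_of_mem_filter J hJ)
  exact hJ'.1 (injOn N t' ht' hJ'.2 hq' hJeq)

/-- A primary component may be replaced by a larger primary submodule with the same prime, provided
that the intersection stays the same. -/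
theorem insert_erase_of_le (ht : N.IsMinimalPrimaryDecomposition t)
    {q q' : Submodule R M} (hq : q ∈ t) (hle : q ≤ q') (hq' : q'.IsPrimary)
    (h : (q'.colon Set.univ).radical = (q.colon Set.univ).radical)
    (hinf : q' ⊓ (t.erase q).inf id ≤ q) :
    N.IsMinimalPrimaryDecomposition (insert q' (t.erase q)) := by
  have hne {J : Submodule R M} (hJ : J ∈ t.erase q) :
      (J.colon Set.univ).radical ≠ (q'.colon Set.univ).radical := fun hJq ↦
    (Finset.mem_erase.mp hJ).1 (injOn N t ht (Finset.mem_of_mem_erase hJ) hq (hJq.trans h))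
  refine isMinimalPrimaryDecomposition_of_image_subset ?_ ?_ ?_ ?_
  · rw [Finset.inf_insert, id, ← ht.inf_inf_erase hq]
    exact le_antisymm (le_inf hinf inf_le_right) (inf_le_inf_right _ hle)
  · intro J hJ
    rcases Finset.mem_insert.mp hJ with rfl | hJ
    exacts [hq', ht.primary (Finset.mem_of_mem_erase hJ)]
  · intro J hJ K hK hJK
    rcases Finset.mem_insert.mp hJ with rfl | hJt <;> rcases Finset.mem_insert.mp hK with rfl | hKt
    · rfl
    · exact absurd hJK.symm (hne hKt)
    · exact absurd hJK (hne hJt)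
    · exact injOn N t ht (Finset.mem_of_mem_erase hJt) (Finset.mem_of_mem_erase hKt) hJK
  · rintro _ ⟨J, hJ, rfl⟩
    rcases Finset.mem_insert.mp hJ with rfl | hJ
    · exact Set.mem_of_eq_of_mem h (ht.mem_associatedPrimes hq)
    · exact ht.mem_associatedPrimes (Finset.mem_of_mem_erase hJ)

theorem maximal_primaryComponents_iff
    (ht : N.IsMinimalPrimaryDecomposition t) {q : Submodule R M} (hq : q ∈ t) :
    Maximal (· ∈ N.primaryComponents (q.colon Set.univ).radical) q ↔
      ∀ Q', q ≤ Q' → Q' ⊓ (t.erase q).inf id ≤ q → Q' = q := by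
  constructor
  · intro hmax Q' hle hinf
    have hprime := (ht.primary hq).isPrime_radical_colon
    set S := (q.colon Set.univ).radical.primeCompl
    -- Since `q` is primary, multipliers outside its prime cancel modulo `q`, so saturating `Q'`
    -- preserves the intersection condition.
    have hinf' : Q'.saturation S ⊓ (t.erase q).inf id ≤ q := by
      rintro x ⟨⟨s, hs, hsx⟩, hx⟩
      exact (ht.primary hq).mem_of_smul_mem hs (hinf ⟨hsx, smul_mem _ s hx⟩)
    have htop : Q'.saturation S ≠ ⊤ := by
      intro htop
      rw [htop, top_inf_eq] at hinf'
      exact ht.minimal hq hinf'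
    obtain ⟨hprim, hrad⟩ := isPrimary_saturation_primeCompl
      (Ideal.radical_mono (colon_mono hle subset_rfl)) htop
    have hle' : q ≤ Q'.saturation S := hle.trans (le_saturation S Q')
    refine le_antisymm ((le_saturation S Q').trans (hmax.2 ⟨hprim, hrad, ?_⟩ hle')) hle
    exact ⟨_, ht.insert_erase_of_le hq hle' hprim hrad hinf', Finset.mem_insert_self _ _⟩
  · intro h
    refine ⟨⟨ht.primary hq, rfl, t, ht, hq⟩, ?_⟩
    rintro Q' ⟨-, hrad, t', ht', hQ'⟩ hle
    refine (h Q' hle ((ht.inf_inf_erase_le_of_radical_eq ht' hq hQ' hrad).trans ?_)).le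
    exact ht.inf_inf_erase hq ▸ inf_le_left

/-- Components at minimal associated primes satisfy the maximality condition automatically. -/
theorem eq_of_minimal
    (ht : N.IsMinimalPrimaryDecomposition t) {q : Submodule R M} (hq : q ∈ t)
    (hmin : Minimal (· ∈ N.associatedPrimes) (q.colon Set.univ).radical) {Q' : Submodule R M}
    (hle : q ≤ Q') (hinf : Q' ⊓ (t.erase q).inf id ≤ q) : Q' = q := by
  have hprime := (ht.primary hq).isPrime_radical_colon
  -- Such an `s` sends `Q'` into `Q' ⊓ (t.erase q).inf id ≤ q` and cancels modulo `q`. Without one,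
  -- the prime of another component would lie inside the minimal prime of `q`.
  obtain ⟨s, hs, hsq⟩ : ∃ s ∈ ((t.erase q).inf id).colon Set.univ,
      s ∉ (q.colon Set.univ).radical := by
    refine SetLike.not_le_iff_exists.mp fun hcolon ↦ ?_
    rw [colon_finsetInf, hprime.inf_le'] at hcolon
    obtain ⟨J, hJ, hJq⟩ := hcolon
    obtain ⟨hJne, hJt⟩ := Finset.mem_erase.mp hJ
    have hJle := hprime.radical_le_iff.mpr hJq
    exact hJne (injOn N t ht hJt hq (hJle.antisymm (hmin.2 (ht.mem_associatedPrimes hJt) hJle)))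
  refine le_antisymm (fun x hx ↦ (ht.primary hq).mem_of_smul_mem hsq ?_) hle
  exact hinf ⟨smul_mem _ s hx, mem_colon.mp hs x (Set.mem_univ x)⟩

end IsMinimalPrimaryDecomposition

end PrimaryComponents

end Submodule

theorem theorem3p2 {R M : Type*} [CommRing R] [IsNoetherianRing R] [AddCommGroup M] [Module R M]
    [Module.Finite R M] (N : Submodule R M) (n : ℕ) (p : Fin n → Ideal R)
    (Q : Fin n ↪ Submodule R M)
    (hQ : N.IsMinimalPrimaryDecomposition (Finset.univ.map Q))
    (hp : ∀ i, ((Q i).colon Set.univ).radical = p i) :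
    N.indexOfReducibility = ∑ i, (Q i).indexOfReducibility ↔
      ∀ i, N.IsEmbeddedPrime (p i) → N.IsMaximalEmbeddedComponent (p i) (Q i) := by
  classical
  have hN : Finset.univ.inf Q = N := by simpa [Finset.inf_map] using hQ.inf_eq
  have herase (i : Fin n) :
      ((Finset.univ.map Q).erase (Q i)).inf id = (Finset.univ.erase i).inf Q := by
    rw [← Finset.map_erase, Finset.inf_map, Function.id_comp]
  have hmem (i : Fin n) : Q i ∈ Finset.univ.map Q := Finset.mem_map_of_mem Q (Finset.mem_univ i)
  rw [← hN, Submodule.indexOfReducibility_eq_sum_iff, hN]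
  refine forall_congr' fun i ↦ ?_
  have hmax := hQ.maximal_primaryComponents_iff (hmem i)
  rw [herase, hp] at hmax
  rw [← hmax]
  refine ⟨fun h _ ↦ h, fun h ↦ ?_⟩
  by_cases hemb : N.IsEmbeddedPrime (p i)
  · exact h hemb
  · have hass : p i ∈ N.associatedPrimes := hp i ▸ hQ.mem_associatedPrimes (hmem i)
    rw [Submodule.IsEmbeddedPrime, Submodule.associatedPrimes_quotient_eq] at hemb
    have hmin : Minimal (· ∈ N.associatedPrimes) (p i) := by
      by_contra hmin
      exact hemb ⟨hass, hmin⟩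
    rw [hmax, ← herase]
    exact fun Q' hle hinf ↦ hQ.eq_of_minimal (hmem i) ((hp i).symm ▸ hmin) hle hinf
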